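/- A partial finite automaton (PFA) is a triple $(Q,\Sigma,\delta)$ with a finite state set $Q$, a finite alphabet $\Sigma$ and a partial function $\delta:Q\times\Sigma\to Q$; it is a DFA if $\delta$ is total, and binary if $|\Sigma|=2$. For a word $w$, let $qw$ be the (possibly undefined) state reached from $q$ by reading $w$. The word $w$ is synchronizing if there is a state $q_s$ such that $qw$ is defined and equal to $q_s$ for all $q\in Q$. The reset threshold $r(A)$ of a PFA $A$ that has a synchronizing word is the length of a shortest such word. Let $p(n,2)$ be the maximal reset threshold of a synchronizing binary PFA with $n$ states, and $d(n)$ the maximal reset threshold of a synchronizing DFA with $n$ states (over any finite alphabet). The Černý conjecture says that for all $n\ge1$ every synchronizing DFA with $n$ states has a synchronizing word of length at most $(n-1)^2$. For $c\ge 0$ and $n\ge c+2$, let $C_n^c$ be the PFA with states $1,\dots,n$, letters $a,b$ and transitions $$qa=\begin{cases}q+1 & 1\le q\le n-c-1\\ \text{undefined} & n-c\le q\le n-1\\ 1 & q=n\end{cases}\qquad qb=\begin{cases}q & 1\le q\le n-c-1\\ q+1 & n-c\le q\le n-1\\ 1 & q=n.\end{cases}$$ **Corollary.** For all $n\ge 6$: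 the automata $C_n^0$ and $C_n^1$ are synchronizing and $r(C_n^1)>r(C_n^0)=(n-1)^2$; the maxima $p(n,2)$ and $d(n)$ exist; $p(n,2)>(n-1)^2$; and if the Černý conjecture holds, then $p(n,2)>d(n)$. -/

import Mathlib

/-- A partial finite automaton with state set `Q` and alphabet `σ` (finiteness is imposed where
automata are quantified over): a partial transition function, `none` meaning undefined. -/
structure PFA (Q σ : Type) where
  step : Q → σ → Option Q

namespace PFA

/-- `A.run q w` is the state `qw` reached from `q` by reading `w` letter by letter from the left;
it is `none` as soon as one of the transitions is undefined. -/
def run {Q σ : Type} (A : PFA Q σ) : Q → List σ → Option Q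
  | q, [] => some q
  | q, a :: w => (A.step q a).bind (fun q' => A.run q' w)

/-- `w` is a synchronizing word: there is a state `s` such that `qw` is defined and equal to `s`
for every state `q`. -/
def IsSyncWord {Q σ : Type} (A : PFA Q σ) (w : List σ) : Prop :=
  ∃ s : Q, ∀ q : Q, A.run q w = some s

/-- The automaton has a synchronizing word. -/
def IsSynchronizing {Q σ : Type} (A : PFA Q σ) : Prop :=
  ∃ w : List σ, A.IsSyncWord w

/-- The automaton is deterministic and complete (a DFA): every transition is defined. -/
def IsDFA {Q σ : Type} (A : PFA Q σ) : Prop :=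
  ∀ (q : Q) (a : σ), A.step q a ≠ none

/-- The length of a shortest synchronizing word (only meaningful for synchronizing automata). -/
noncomputable def resetThreshold {Q σ : Type} (A : PFA Q σ) : ℕ :=
  sInf {l : ℕ | ∃ w : List σ, A.IsSyncWord w ∧ w.length = l}

/-- All reset thresholds of synchronizing PFAs with `n` states and `k` letters. -/
def thresholdsPFA (n k : ℕ) : Set ℕ :=
  {r : ℕ | ∃ (Q σ : Type) (_ : Fintype Q) (_ : Fintype σ) (A : PFA Q σ),
    Fintype.card Q = n ∧ Fintype.card σ = k ∧ A.IsSynchronizing ∧ A.resetThreshold = r}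

/-- All reset thresholds of synchronizing DFAs with `n` states, over arbitrary finite alphabets. -/
def thresholdsDFA (n : ℕ) : Set ℕ :=
  {r : ℕ | ∃ (Q σ : Type) (_ : Fintype Q) (_ : Fintype σ) (A : PFA Q σ),
    Fintype.card Q = n ∧ A.IsDFA ∧ A.IsSynchronizing ∧ A.resetThreshold = r}

/-- `p(n, k)`: the maximal reset threshold of a PFA with `n` states and `k` letters. -/
noncomputable def maxThresholdPFA (n k : ℕ) : ℕ := sSup (thresholdsPFA n k)

/-- `d(n)`: the maximal reset threshold of a DFA with `n` states. -/
noncomputable def maxThresholdDFA (n : ℕ) : ℕ := sSup (thresholdsDFA n)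

/-- The Cerny conjecture: every synchronizing DFA on `n` states admits a synchronizing word of
length at most `(n - 1) ^ 2`. (A synchronizing automaton has at least one state.) -/
def CernyConjecture : Prop :=
  ∀ (Q σ : Type) [Fintype Q] [Fintype σ] (A : PFA Q σ), A.IsDFA → A.IsSynchronizing →
    ∃ w : List σ, A.IsSyncWord w ∧ w.length ≤ (Fintype.card Q - 1) ^ 2

/-- The binary alphabet `{a, b}`. -/
inductive Letter where
  | a
  | b

/-- The automaton `C_n^c` of the Cerny family (for `n ≥ c + 2`). The state `q ∈ {1, …, n}` is
represented by `q - 1 : Fin n`, so that `q ≤ n - c - 1` becomes `i + c + 1 < n` for `i = q - 1`,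
and `q ≤ n - 1` becomes `i + 1 < n`. -/
def cerny (n c : ℕ) : PFA (Fin n) Letter where
  step i x :=
    match x with
    | Letter.a =>
      if h : i.val + c + 1 < n then some ⟨i.val + 1, by omega⟩
      else if i.val + 1 < n then none
      else some ⟨0, i.pos⟩
    | Letter.b =>
      if i.val + c + 1 < n then some i
      else if h : i.val + 1 < n then some ⟨i.val + 1, h⟩
      else some ⟨0, i.pos⟩

end PFA

/-! View the reached states as tokens on a circle of `m` sites: a letter either rotates all tokens
or pushes only the token at the last site to site `0`, possibly merging it. A singleton has a gap of
length `m` behind its token. The longest gap grows by at most one per push, and the token in front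
of it must first travel round the circle before it can be pushed again. `GapBound` turns this into a
potential, the weight of a gap plus the position of its token, whose bound rises by one per letter
when `e = 0`. For `C_n^0` the circle has `n` sites. The bound starts at `n - 1` and must reach `(n -
1) * n`, so `(n - 1) ^ 2` letters are needed, and the word `b(a^(n-1)b)^(n-2)` attains this.

For `C_n^1`, identifying the last two states gives a circle of `m = n - 1` sites. A token rotated to
site `m - 1` forces an extra `b`, as `a` is undefined there; hence `e = 1`, and a turn costs `m`
plus the number of tokens. While all gaps are at most `l`, there are at least `⌈m/l⌉` tokens. Summed
over `l`, this yields `m ^ 2` letters after the forced first `b`, provided `m ≥ 7`; the cases `n =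
6, 7` are settled by exhaustive search. -/

open Finset

/-! ### A potential for the merging game on a circle -/

/-- The `l - 1` sites cyclically preceding `q` on the circle `{0, …, m - 1}` carry no element
of `T`. -/
def GapBehind (m : ℕ) (T : Finset ℕ) (q l : ℕ) : Prop :=
  ∀ j, 0 < j → j < l → (j ≤ q → q - j ∉ T) ∧ (q < j → q + m - j ∉ T)

/-- `T'` arises from `T` by moving every element one site forward. -/
def IsRotation (m : ℕ) (T T' : Finset ℕ) : Prop :=
  ∀ x, x ∈ T' ↔ (x = 0 ∧ m - 1 ∈ T) ∨ (0 < x ∧ x < m ∧ x - 1 ∈ T)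

/-- `T'` arises from `T` by moving only the element at the last site, if any, to site `0`. -/
def IsPush (m : ℕ) (T T' : Finset ℕ) : Prop :=
  ∀ x, x ∈ T' ↔ x < m - 1 ∧ (x ∈ T ∨ (x = 0 ∧ m - 1 ∈ T))

/-- The indicator of `x ∈ T`. -/
def occ (T : Finset ℕ) (x : ℕ) : ℕ := if x ∈ T then 1 else 0

/-- The weight of a gap of length `l`, where visits to occupied sites count with weight `e`. -/
def gapWeight (m e l : ℕ) : ℕ := ∑ i ∈ Ico 1 l, (m + e * ((m + i - 1) / i))

/-- The potential of every gap is bounded by `t`. -/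
def GapBound (m e : ℕ) (T : Finset ℕ) (t : ℕ) : Prop :=
  ∀ q ∈ T, ∀ l, 1 ≤ l → l ≤ m → GapBehind m T q l →
    gapWeight m e l + q + e * (#{x ∈ T | x < q} + occ T (m - 1)) ≤ t

theorem gapWeight_one (m e : ℕ) : gapWeight m e 1 = 0 := by simp [gapWeight]

theorem gapWeight_succ (m e l : ℕ) (hl : 1 ≤ l) :
    gapWeight m e (l + 1) = gapWeight m e l + (m + e * ((m + l - 1) / l)) := by
  simp [gapWeight, sum_Ico_succ_top hl]

/-- If no gap is longer than `l`, the circle has at most `l * #T` sites. -/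
theorem le_card_mul_of_no_gap {m l : ℕ} {T : Finset ℕ} (hT : ∀ x ∈ T, x < m) (hne : T.Nonempty)
    (h : ∀ q ∈ T, ¬ GapBehind m T q (l + 1)) : m ≤ #T * l := by
  classical
  obtain ⟨p, hp⟩ := hne
  have hpm := hT p hp
  let f : ℕ × ℕ → ℕ := fun z => if z.2 ≤ z.1 then z.1 - z.2 else z.1 + m - z.2
  -- Walking forward, every site meets an element of `T` in fewer than `l` steps, so the pairs
  -- (element, distance) cover the circle.
  have hsub : range m ⊆ (T ×ˢ range l).image f := by
    intro x hx
    have hx := mem_range.1 hx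
    let g : ℕ → ℕ := fun j => if x + j < m then x + j else x + j - m
    have hex : ∃ j, j < m ∧ g j ∈ T := by
      rcases le_or_gt x p with h1 | h1
      · exact ⟨p - x, by omega, by simpa [g, Nat.add_sub_cancel' h1, hpm] using hp⟩
      · refine ⟨p + m - x, by omega, ?_⟩
        have : ¬ (x + (p + m - x) < m) := by omega
        have h2 : x + (p + m - x) - m = p := by omega
        simpa only [g, this, if_false, h2] using hp
    classical
    have hj := Nat.find_spec hex
    have hmin : ∀ i, i < Nat.find hex → g i ∉ T := fun i hi hg =>
      Nat.find_min hex hi ⟨hi.trans hj.1, hg⟩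
    generalize Nat.find hex = j at hj hmin
    have hjl : j < l := by
      by_contra hjl
      refine h _ hj.2 fun i hi hil => ⟨fun h1 h2 => hmin (j - i) (by omega) ?_,
        fun h1 h2 => hmin (j - i) (by omega) ?_⟩
      · convert h2 using 1
        simp only [g] at h1 ⊢
        split_ifs at h1 ⊢ <;> omega
      · convert h2 using 1
        simp only [g] at h1 ⊢
        split_ifs at h1 ⊢ <;> omega
    refine mem_image.2 ⟨(g j, j), mem_product.2 ⟨hj.2, mem_range.2 hjl⟩, ?_⟩
    simp only [f, g]
    split_ifs <;> omega
  calc m = #(range m) := (card_range m).symm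
    _ ≤ #((T ×ˢ range l).image f) := card_le_card hsub
    _ ≤ #(T ×ˢ range l) := card_image_le
    _ = #T * l := by simp

theorem GapBound.mono {m e : ℕ} {T : Finset ℕ} {t u : ℕ} (h : GapBound m e T t) (htu : t ≤ u) :
    GapBound m e T u := fun q hq l h1 h2 h3 => (h q hq l h1 h2 h3).trans htu

/-- Moving one site forward costs 1. A token going from `m - 1` to `0` joins those counted below
`q`, which `occ T (m - 1)` has prepaid; the only new charge is for a token arriving from `m - 2`. -/
theorem GapBound.rotation {m e : ℕ} {T T' : Finset ℕ} {t : ℕ} (hm : 2 ≤ m)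
    (h : GapBound m e T t) (hr : IsRotation m T T') :
    GapBound m e T' (t + 1 + e * occ T (m - 2)) := by
  intro q' hq' l hl1 hlm hgap
  have hocc : occ T' (m - 1) = occ T (m - 2) := by
    have := hr (m - 1)
    have h2 : m - 1 - 1 = m - 2 := by omega
    rw [h2] at this
    have : m - 1 ∈ T' ↔ m - 2 ∈ T := by
      rw [this]
      exact ⟨fun h => h.elim (fun h => by omega) (fun h => h.2.2),
        fun h => Or.inr ⟨by omega, by omega, h⟩⟩
    simp only [occ, this]
  rw [hocc]
  rcases (hr q').1 hq' with ⟨rfl, hq⟩ | ⟨h0, hqm, hq⟩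
  · have hb := h _ hq l hl1 hlm (fun j hj0 hjl => by
      have := hgap j hj0 hjl
      refine ⟨fun _ hx => this.2 (by omega) ((hr _).2 (Or.inr ⟨by omega, by omega, ?_⟩)),
        fun hc => by omega⟩
      convert hx using 1
      omega)
    simp only [not_lt_zero, filter_false, card_empty, mul_add]
    nlinarith
  · have hb := h _ hq l hl1 hlm (fun j hj0 hjl => by
      have := hgap j hj0 hjl
      refine ⟨fun hc hx => this.1 (by omega) ((hr _).2 (Or.inr ⟨by omega, by omega, ?_⟩)),
        fun hc hx => ?_⟩
      · convert hx using 1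
        omega
      · rcases eq_or_ne j q' with rfl | hne
        · refine this.1 le_rfl ((hr _).2 (Or.inl ⟨by omega, ?_⟩))
          convert hx using 1
          omega
        · refine this.2 (by omega) ((hr _).2 (Or.inr ⟨by omega, by omega, ?_⟩))
          convert hx using 1
          omega)
    have hcard : #{x ∈ T' | x < q'} ≤ #{x ∈ T | x < q' - 1} + occ T (m - 1) := by
      have hsub : {x ∈ T' | x < q'} ⊆
          ({x ∈ T | x < q' - 1}.image (· + 1)) ∪ (if m - 1 ∈ T then {0} else ∅) := by
        intro x hx
        rw [mem_filter, hr] at hx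
        rw [mem_union, mem_image]
        rcases hx with ⟨⟨rfl, hx⟩ | ⟨h1, h2, h3⟩, hlt⟩
        · right; simp [hx]
        · left; exact ⟨x - 1, mem_filter.2 ⟨h3, by omega⟩, by omega⟩
      refine (card_le_card hsub).trans ((card_union_le _ _).trans ?_)
      refine add_le_add card_image_le ?_
      unfold occ
      split_ifs <;> simp
    have := Nat.mul_le_mul_left e hcard
    rw [mul_add]
    omega

/-- Only the gap behind site `0` can become critical: it is one longer than the gap that was behind
`m - 1`. The increment of `gapWeight` is chosen to be covered by the position `m - 1` and the token
count there. -/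
theorem GapBound.push {m e : ℕ} {T T' : Finset ℕ} {t : ℕ} (hm : 2 ≤ m)
    (hT : ∀ x ∈ T, x < m) (h : GapBound m e T t) (hr : IsPush m T T') :
    GapBound m e T' (t + 1) := by
  have hocc : occ T' (m - 1) = 0 := by
    have := hr (m - 1)
    simp [occ, this]
  by_cases hlast : m - 1 ∈ T
  · intro q' hq' l' hl1 hlm hgap
    rw [hocc]
    have hoccT : occ T (m - 1) = 1 := by simp [occ, hlast]
    rcases Nat.eq_zero_or_pos q' with rfl | hq0
    · simp only [not_lt_zero, filter_false, card_empty, mul_zero, add_zero]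
      rcases Nat.eq_or_lt_of_le hl1 with rfl | hl2
      · simp [gapWeight_one]
      obtain ⟨l, rfl⟩ : ∃ l, l' = l + 1 := ⟨l' - 1, by omega⟩
      -- Either a gap of the new length existed before and already paid for it, or all gaps are at
      -- most `l` and there are at least `⌈m/l⌉` tokens.
      by_cases hex : ∃ q ∈ T, GapBehind m T q (l + 1)
      · obtain ⟨q, hq, hg⟩ := hex
        have := h q hq _ hl1 hlm hg
        omega
      · have hcov := le_card_mul_of_no_gap hT ⟨_, hlast⟩ (l := l) (by simpa using hex)
        have hb := h _ hlast l (by omega) (by omega) (fun j hj0 hjl => by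
          have := hgap (j + 1) (by omega) (by omega)
          refine ⟨fun _ hx => this.2 (by omega) ((hr _).2 ⟨by omega, Or.inl ?_⟩),
            fun hc => by omega⟩
          convert hx using 1
          omega)
        have hc : #{x ∈ T | x < m - 1} + 1 = #T := by
          have : {x ∈ T | x < m - 1} = T.erase (m - 1) := by
            ext x
            simp only [mem_filter, mem_erase]
            constructor
            · rintro ⟨h1, h2⟩; exact ⟨by omega, h1⟩
            · rintro ⟨h1, h2⟩; exact ⟨h2, by have := hT x h2; omega⟩
          rw [this, card_erase_add_one hlast]
        rw [hoccT, hc] at hb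
        have hdiv : (m + l - 1) / l ≤ #T := by
          refine Nat.le_of_lt_succ ((Nat.div_lt_iff_lt_mul (by omega)).2 ?_)
          rw [Nat.succ_mul]
          omega
        rw [gapWeight_succ _ _ _ (by omega)]
        have := Nat.mul_le_mul_left e hdiv
        omega
    · have hq := (hr q').1 hq'
      have hqT : q' ∈ T := by
        rcases hq.2 with h1 | h1
        · exact h1
        · omega
      have hb := h q' hqT l' hl1 hlm (fun j hj0 hjl => by
        have hj := hgap j hj0 hjl
        refine ⟨fun hc hx => hj.1 hc ((hr _).2 ⟨by omega, Or.inl hx⟩), fun hc hx => ?_⟩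
        -- This `j` points at site `m - 1`, the only one vacated; but a gap reaching it would have
        -- to pass site `0`, which is now occupied.
        by_cases hj1 : j = q' + 1
        · refine (hgap q' hq0 (by omega)).1 le_rfl ((hr _).2 ⟨by omega, Or.inr ⟨by omega, hlast⟩⟩)
        · exact hj.2 hc ((hr _).2 ⟨by omega, Or.inl hx⟩))
      have hcard : #{x ∈ T' | x < q'} ≤ #{x ∈ T | x < q'} + 1 := by
        have hsub : {x ∈ T' | x < q'} ⊆ insert 0 {x ∈ T | x < q'} := by
          intro x hx
          rw [mem_filter, hr] at hx
          rw [mem_insert, mem_filter]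
          tauto
        exact (card_le_card hsub).trans (card_insert_le _ _)
      rw [hoccT] at hb
      have := Nat.mul_le_mul_left e hcard
      rw [add_zero]
      omega
  · have : T' = T := by
      ext x
      rw [hr]
      constructor
      · rintro ⟨h1, h2 | h2⟩
        · exact h2
        · exact absurd h2.2 hlast
      · intro hx
        have := hT x hx
        have : x ≠ m - 1 := fun h => hlast (h ▸ hx)
        exact ⟨by omega, Or.inl hx⟩
    rw [this]
    exact h.mono (Nat.le_succ t)

/-! ### Initial and final values of the potential -/

theorem gapBound_range (m e : ℕ) (hm : 1 ≤ m) : GapBound m e (range m) (m - 1 + e * m) := by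
  intro q hq l hl1 hlm hgap
  have hq := mem_range.1 hq
  have hl : l = 1 := by
    by_contra hne
    have := hgap 1 one_pos (by omega)
    rcases Nat.eq_zero_or_pos q with rfl | h0
    · exact this.2 one_pos (mem_range.2 (by omega))
    · exact this.1 h0 (mem_range.2 (by omega))
  subst hl
  have h1 : #{x ∈ range m | x < q} ≤ q := by
    calc _ ≤ #(range q) := card_le_card fun x hx => by simp at hx ⊢; exact hx.2
      _ = q := card_range q
  have h2 : occ (range m) (m - 1) ≤ 1 := by unfold occ; split_ifs <;> simp
  have := Nat.mul_le_mul_left e (show #{x ∈ range m | x < q} + occ (range m) (m - 1) ≤ m by omega)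
  rw [gapWeight_one]
  omega

theorem GapBound.singleton {m e q t : ℕ} (hq : q < m) (h : GapBound m e {q} t) :
    gapWeight m e m + q ≤ t := by
  have := h q (mem_singleton_self q) m (by omega) le_rfl (fun j h0 hj => by
    simp only [mem_singleton]
    omega)
  omega

theorem gapWeight_zero (m : ℕ) : gapWeight m 0 m = (m - 1) * m := by
  simp [gapWeight]

/-- Here `⌈m/i⌉ ≥ 2` for `4 ≤ i < m`, while `i = 1, 2, 3` are kept exactly; what remains is `⌈m/2⌉ +
⌈m/3⌉ ≥ 7`, true from `m = 7` on. The bound fails for `m = 5, 6`. -/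
theorem le_gapWeight_one {m : ℕ} (hm : 7 ≤ m) : m ^ 2 + 2 * m - 1 ≤ gapWeight m 1 m := by
  have h4 : gapWeight m 1 4 + ∑ i ∈ Ico 4 m, (m + 1 * ((m + i - 1) / i)) = gapWeight m 1 m :=
    sum_Ico_consecutive _ (by omega) (by omega)
  have hs : ∑ i ∈ Ico 4 m, (m + 2) ≤ ∑ i ∈ Ico 4 m, (m + 1 * ((m + i - 1) / i)) := by
    refine sum_le_sum fun i hi => ?_
    have hi := mem_Ico.1 hi
    have := (Nat.le_div_iff_mul_le (show 0 < i by omega)).2 (show 2 * i ≤ m + i - 1 by omega)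
    omega
  rw [sum_const, Nat.card_Ico, smul_eq_mul] at hs
  rw [gapWeight_succ _ _ _ (by norm_num), gapWeight_succ _ _ _ (by norm_num),
    gapWeight_succ _ _ _ le_rfl, gapWeight_one] at h4
  obtain ⟨k, rfl⟩ : ∃ k, m = k + 7 := ⟨m - 7, by omega⟩
  have h1 : k + 7 - 4 = k + 3 := by omega
  rw [h1] at hs
  have : (k + 7) ^ 2 + 2 * (k + 7) = (k + 3) * (k + 7 + 2) + 4 * k + 36 := by ring
  omega

namespace PFA

/-! ### Reset thresholds are bounded in terms of the number of states -/

section General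

variable {Q σ : Type} (A : PFA Q σ)

theorem run_append (q : Q) (u v : List σ) :
    A.run q (u ++ v) = (A.run q u).bind fun q' => A.run q' v := by
  induction u generalizing q with
  | nil => rfl
  | cons x u ih =>
    simp only [List.cons_append, run, Option.bind_assoc]
    congr 1
    funext q'
    exact ih q'

theorem resetThreshold_le {w : List σ} (hw : A.IsSyncWord w) : A.resetThreshold ≤ w.length :=
  Nat.sInf_le ⟨w, hw, rfl⟩

theorem exists_isSyncWord_length (hA : A.IsSynchronizing) :
    ∃ w, A.IsSyncWord w ∧ w.length = A.resetThreshold := by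
  obtain ⟨w, hw⟩ := hA
  exact Nat.sInf_mem (s := {l : ℕ | ∃ w : List σ, A.IsSyncWord w ∧ w.length = l})
    ⟨w.length, w, hw, rfl⟩

/-- A shortest synchronizing word is no longer than the number of partial maps on the states:
otherwise two of its prefixes act in the same way, and the part between them can be cut out. -/
theorem resetThreshold_lt [Fintype Q] (hA : A.IsSynchronizing) :
    A.resetThreshold < (Fintype.card Q + 1) ^ Fintype.card Q := by
  classical
  obtain ⟨w, ⟨s, hs⟩, hlen⟩ := A.exists_isSyncWord_length hA
  by_contra! hlt
  obtain ⟨i, j, hij, heq⟩ := Fintype.exists_ne_map_eq_of_card_lt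
    (fun (i : Fin (w.length + 1)) (q : Q) => A.run q (w.take i)) (by simp; omega)
  wlog hlt' : i < j generalizing i j
  · exact this j i hij.symm heq.symm (lt_of_le_of_ne (not_lt.1 hlt') hij.symm)
  have hsync : A.IsSyncWord (w.take i ++ w.drop j) := by
    refine ⟨s, fun q => ?_⟩
    have h1 : A.run q (w.take i) = A.run q (w.take j) := congrFun heq q
    rw [run_append, h1, ← run_append, List.take_append_drop]
    exact hs q
  have h1 := A.resetThreshold_le hsync
  have h2 : (i : ℕ) < j := hlt'
  have h3 := j.2
  simp only [List.length_append, List.length_take, List.length_drop] at h1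
  omega

end General

/-- Boundedness makes the `sSup` an attained maximum instead of the default value `0`. -/
theorem bddAbove_thresholdsPFA (n k : ℕ) : BddAbove (thresholdsPFA n k) := by
  refine ⟨(n + 1) ^ n, ?_⟩
  rintro r ⟨Q, σ, _, _, A, rfl, -, hA, rfl⟩
  exact (A.resetThreshold_lt hA).le

theorem bddAbove_thresholdsDFA (n : ℕ) : BddAbove (thresholdsDFA n) := by
  refine ⟨(n + 1) ^ n, ?_⟩
  rintro r ⟨Q, σ, _, _, A, rfl, -, hA, rfl⟩
  exact (A.resetThreshold_lt hA).le

/-! ### Lower bounds for synchronizing words -/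

/-- If a family of sets of states, indexed by a time bound, is closed under reading a letter and
contains no singleton before time `N`, then no shorter word synchronizes its members. -/
theorem le_length_of_invariant {Q σ : Type} (A : PFA Q σ) (I : Finset Q → ℕ → Prop) (N : ℕ)
    (hstep : ∀ S t x S', I S t → (∀ q ∈ S, ∃ q' ∈ S', A.step q x = some q') →
      (∀ q' ∈ S', ∃ q ∈ S, A.step q x = some q') → I S' (t + 1))
    (hend : ∀ s t, I {s} t → N ≤ t) (w : List σ) (S : Finset Q) (t : ℕ) (s : Q) (hI : I S t)
    (hne : S.Nonempty) (hw : ∀ q ∈ S, A.run q w = some s) : N ≤ t + w.length := by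
  classical
  induction w generalizing S t with
  | nil =>
    have : S = {s} := by
      refine eq_singleton_iff_nonempty_unique_mem.2 ⟨hne, fun q hq => ?_⟩
      simpa [run] using hw q hq
    subst this
    exact hend s t hI
  | cons x w ih =>
    have hdef : ∀ q ∈ S, ∃ q', A.step q x = some q' ∧ A.run q' w = some s := fun q hq => by
      simpa [run, Option.bind_eq_some_iff] using hw q hq
    let S' : Finset Q := S.biUnion fun q => (A.step q x).toFinset
    have hS' : ∀ q', q' ∈ S' ↔ ∃ q ∈ S, A.step q x = some q' := by simp [S']
    have hfwd : ∀ q ∈ S, ∃ q' ∈ S', A.step q x = some q' := fun q hq => by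
      obtain ⟨q', h1, -⟩ := hdef q hq
      exact ⟨q', (hS' q').2 ⟨q, hq, h1⟩, h1⟩
    have := ih S' (t + 1) (hstep S t x S' hI hfwd fun q' hq' => (hS' q').1 hq')
      (let ⟨q, hq⟩ := hne; let ⟨q', h, _⟩ := hfwd q hq; ⟨q', h⟩)
      (fun q' hq' => by
        obtain ⟨q, hq, h1⟩ := (hS' q').1 hq'
        obtain ⟨r, h2, h3⟩ := hdef q hq
        rw [h1] at h2
        cases h2
        exact h3)
    rw [List.length_cons]
    omega

end PFA

/-! ### The action of the letters on states and on sets of positions -/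

namespace PFA

section Step

variable {n c : ℕ} {i : Fin n}

theorem cerny_step_a_lt (h : i.val + c + 1 < n) :
    (cerny n c).step i Letter.a = some ⟨i.val + 1, by omega⟩ := by
  simp [cerny, h]

theorem cerny_step_a_none (h : n ≤ i.val + c + 1) (h' : i.val + 1 < n) :
    (cerny n c).step i Letter.a = none := by
  simp [cerny, h.not_gt, h']

theorem cerny_step_a_last (h : i.val + 1 = n) :
    (cerny n c).step i Letter.a = some ⟨0, i.pos⟩ := by
  simp [cerny, show ¬ i.val + c + 1 < n by omega, h]

theorem cerny_step_b_lt (h : i.val + c + 1 < n) : (cerny n c).step i Letter.b = some i := by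
  simp [cerny, h]

theorem cerny_step_b_mid (h : n ≤ i.val + c + 1) (h' : i.val + 1 < n) :
    (cerny n c).step i Letter.b = some ⟨i.val + 1, h'⟩ := by
  simp [cerny, h.not_gt, h']

theorem cerny_step_b_last (h : i.val + 1 = n) :
    (cerny n c).step i Letter.b = some ⟨0, i.pos⟩ := by
  simp [cerny, show ¬ i.val + c + 1 < n by omega, h]

end Step

/-- The positions of a set of states of an automaton of the Cerny family. -/
def positions {n : ℕ} (S : Finset (Fin n)) : Finset ℕ := S.image Fin.val

/-- `S'` is the image of `S` under the letter `x`, which is defined on `S`. -/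
def IsImage {Q σ : Type} (A : PFA Q σ) (x : σ) (S S' : Finset Q) : Prop :=
  (∀ q ∈ S, ∃ q' ∈ S', A.step q x = some q') ∧ ∀ q' ∈ S', ∃ q ∈ S, A.step q x = some q'

theorem mem_positions {n : ℕ} {S : Finset (Fin n)} {x : ℕ} :
    x ∈ positions S ↔ ∃ h : x < n, ⟨x, h⟩ ∈ S := by
  simp only [positions, mem_image]
  constructor
  · rintro ⟨i, hi, rfl⟩
    exact ⟨i.2, hi⟩
  · rintro ⟨h, hx⟩
    exact ⟨_, hx, rfl⟩

theorem positions_singleton {n : ℕ} (s : Fin n) : positions {s} = {s.val} := rfl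

theorem IsImage.mem_positions_a {n c : ℕ} {S S' : Finset (Fin n)}
    (h : IsImage (cerny n c) Letter.a S S') (x : ℕ) :
    x ∈ positions S' ↔
      (0 < x ∧ x + c < n ∧ x - 1 ∈ positions S) ∨ (x = 0 ∧ n - 1 ∈ positions S) := by
  simp only [mem_positions]
  constructor
  · rintro ⟨hx, hS⟩
    obtain ⟨q, hq, hs⟩ := h.2 _ hS
    simp only [cerny] at hs
    split_ifs at hs with h1 h2
    · simp only [Option.some.injEq, Fin.mk.injEq] at hs
      subst hs
      exact Or.inl ⟨by omega, by omega, q.2, by simpa using hq⟩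
    · simp only [Option.some.injEq, Fin.mk.injEq] at hs
      refine Or.inr ⟨hs.symm, by omega, ?_⟩
      convert hq using 1
      ext
      simp only
      omega
  · rintro (⟨h0, hx, h1, hq⟩ | ⟨rfl, h1, hq⟩) <;> obtain ⟨q', hq', hs⟩ := h.1 _ hq
    · simp only [cerny] at hs
      split_ifs at hs with h2 h3
      · cases hs
        exact ⟨by omega, by convert hq' using 2; omega⟩
      · omega
    · simp only [cerny] at hs
      split_ifs at hs with h2 h3
      · omega
      · cases hs
        exact ⟨by omega, hq'⟩

theorem IsImage.not_mem_positions_a {n c : ℕ} {S S' : Finset (Fin n)}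
    (h : IsImage (cerny n c) Letter.a S S') (x : ℕ) (h1 : n ≤ x + c + 1) (h2 : x + 1 < n) :
    x ∉ positions S := by
  rw [mem_positions]
  rintro ⟨hx, hq⟩
  obtain ⟨q', -, hs⟩ := h.1 _ hq
  simp [cerny, h2, h1.not_gt] at hs

theorem IsImage.mem_positions_b {n c : ℕ} {S S' : Finset (Fin n)}
    (h : IsImage (cerny n c) Letter.b S S') (x : ℕ) :
    x ∈ positions S' ↔ (x + c + 1 < n ∧ x ∈ positions S) ∨
      (n ≤ x + c ∧ x < n ∧ 0 < x ∧ x - 1 ∈ positions S) ∨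
      (x = 0 ∧ n - 1 ∈ positions S) := by
  simp only [mem_positions]
  constructor
  · rintro ⟨hx, hS⟩
    obtain ⟨q, hq, hs⟩ := h.2 _ hS
    simp only [cerny] at hs
    split_ifs at hs with h1 h2
    · cases hs
      exact Or.inl ⟨h1, hx, hq⟩
    · simp only [Option.some.injEq, Fin.mk.injEq] at hs
      subst hs
      exact Or.inr (Or.inl ⟨by omega, by omega, by omega, q.2, by simpa using hq⟩)
    · simp only [Option.some.injEq, Fin.mk.injEq] at hs
      refine Or.inr (Or.inr ⟨hs.symm, by omega, ?_⟩)
      convert hq using 1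
      ext
      simp only
      omega
  · rintro (⟨h0, h1, hq⟩ | ⟨h0, hx, hx0, h1, hq⟩ | ⟨rfl, h1, hq⟩) <;>
      obtain ⟨q', hq', hs⟩ := h.1 _ hq
    · simp only [cerny, h0, if_true] at hs
      cases hs
      exact ⟨h1, hq'⟩
    · simp only [cerny] at hs
      split_ifs at hs with h2 h3
      · omega
      · cases hs
        exact ⟨by omega, by convert hq' using 2; omega⟩
      · omega
    · simp only [cerny] at hs
      split_ifs at hs with h2 h3
      · omega
      · omega
      · cases hs
        exact ⟨by omega, hq'⟩

/-! ### The automaton `C_n^0` -/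

theorem le_length_cerny_zero {n : ℕ} (hn : 2 ≤ n) {w : List Letter}
    (hw : (cerny n 0).IsSyncWord w) : (n - 1) ^ 2 ≤ w.length := by
  obtain ⟨s, hs⟩ := hw
  have hpos : ∀ S : Finset (Fin n), ∀ x ∈ positions S, x < n := fun S x hx =>
    (mem_positions.1 hx).1
  have := le_length_of_invariant (cerny n 0)
    (fun S t => GapBound n 0 (positions S) (n - 1 + 0 * n + t)) ((n - 1) ^ 2) ?_ ?_ w univ 0 s ?_
    ⟨s, mem_univ s⟩ (fun q _ => hs q)
  · omega
  · intro S t x S' hI hf hb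
    have him : IsImage (cerny n 0) x S S' := ⟨hf, hb⟩
    cases x with
    | a =>
      refine (hI.rotation hn (T' := positions S') fun x => ?_).mono (by omega)
      rw [him.mem_positions_a, add_zero]
      exact Or.comm
    | b =>
      refine hI.push hn (hpos S) (T' := positions S') fun x => ?_
      have := hpos S x
      rw [him.mem_positions_b]
      constructor
      · rintro (h | h | h)
        · exact ⟨by omega, Or.inl h.2⟩
        · omega
        · exact ⟨by omega, Or.inr h⟩
      · rintro ⟨h1, h2 | h2⟩
        · exact Or.inl ⟨by omega, h2⟩
        · exact Or.inr (Or.inr h2)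
  · intro q t hI
    have := GapBound.singleton q.2 hI
    rw [gapWeight_zero] at this
    obtain ⟨k, rfl⟩ : ∃ k, n = k + 1 := ⟨n - 1, by omega⟩
    simp only [add_tsub_cancel_right, zero_mul, add_zero] at this ⊢
    nlinarith
  · have : positions (univ : Finset (Fin n)) = range n := by
      ext x
      simp [mem_positions]
    simpa only [this, add_zero] using gapBound_range n 0 (by omega)

/-! ### The automaton `C_n^1` -/

/-- The positions on the circle of length `m` that arises by identifying `m - 1` with `m`. -/
def collapse (m : ℕ) (V : Finset ℕ) : Finset ℕ := V.image fun x => min x (m - 1)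

theorem mem_collapse {m : ℕ} {V : Finset ℕ} (hV : ∀ x ∈ V, x < m + 1) (x : ℕ) :
    x ∈ collapse m V ↔ (x + 1 < m ∧ x ∈ V) ∨ (x = m - 1 ∧ (m - 1 ∈ V ∨ m ∈ V)) := by
  simp only [collapse, mem_image]
  constructor
  · rintro ⟨y, hy, rfl⟩
    have := hV y hy
    rcases lt_trichotomy y (m - 1) with h | rfl | h
    · rw [min_eq_left h.le]
      exact Or.inl ⟨by omega, hy⟩
    · exact Or.inr ⟨by omega, Or.inl hy⟩
    · obtain rfl : y = m := by omega
      exact Or.inr ⟨by omega, Or.inr hy⟩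
  · rintro (⟨h, hx⟩ | ⟨rfl, hx | hx⟩)
    · exact ⟨x, hx, by omega⟩
    · exact ⟨_, hx, by omega⟩
    · exact ⟨_, hx, by omega⟩

/-- The invariant for `C_n^1`, `n = m + 1`: a letter `b` is due if the state `m - 1`, on which `a`
is undefined, is occupied. -/
def CircleInvariant (m : ℕ) (V : Finset ℕ) (t : ℕ) : Prop :=
  ¬ (m - 1 ∈ V ∧ m ∈ V) ∧ GapBound m 1 (collapse m V) (m - 1 + 1 * m + t + occ V (m - 1))

/-- On the collapsed circle `a` rotates, and `b` pushes if state `m - 1` is empty. The term `occ V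
(m - 1)` records the extra charge of a rotation until the `b` that is due settles it. -/
theorem CircleInvariant.image {m t : ℕ} {x : Letter} {S S' : Finset (Fin (m + 1))} (hm : 2 ≤ m)
    (h : CircleInvariant m (positions S) t) (him : IsImage (cerny (m + 1) 1) x S S') :
    CircleInvariant m (positions S') (t + 1) := by
  have hV : ∀ S : Finset (Fin (m + 1)), ∀ x ∈ positions S, x < m + 1 := fun S x hx =>
    (mem_positions.1 hx).1
  have hC := mem_collapse (hV S)
  have hC' := mem_collapse (hV S')
  have hlt : ∀ x ∈ collapse m (positions S), x < m := fun x hx => by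
    rw [hC] at hx
    omega
  obtain ⟨hnot, hG⟩ := h
  cases x with
  | a =>
    have ha := him.mem_positions_a
    have hun := him.not_mem_positions_a (m - 1) (by omega) (by omega)
    generalize positions S = V at *
    generalize positions S' = V' at *
    have h1 : m + 1 - 1 = m := rfl
    have h2 : m - 1 - 1 = m - 2 := by omega
    refine ⟨fun h => by have := (ha m).1 h.2; omega, ?_⟩
    have ho : occ V (m - 1) = 0 := by simp [occ, hun]
    have ho' : occ V' (m - 1) = occ (collapse m V) (m - 2) := by
      have : m - 1 ∈ V' ↔ m - 2 ∈ collapse m V := by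
        rw [ha, hC, h2]
        constructor
        · rintro (h | h)
          · exact Or.inl ⟨by omega, h.2.2⟩
          · omega
        · rintro (h | h)
          · exact Or.inl ⟨by omega, by omega, h.2⟩
          · omega
      simp only [occ, this]
    refine (hG.rotation hm (T' := collapse m V') fun x => ?_).mono (by omega)
    rw [hC', hC, hC, ha, ha, ha, h1, h2]
    clear * - hm hun
    grind
  | b =>
    have hb := him.mem_positions_b
    have hVS := hV S
    generalize positions S = V at *
    generalize positions S' = V' at *
    have h1 : m + 1 - 1 = m := rfl
    have hm' : m - 1 ∉ V' := fun h => by have := (hb _).1 h; omega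
    refine ⟨fun h => hm' h.1, ?_⟩
    have ho' : occ V' (m - 1) = 0 := by simp [occ, hm']
    rw [ho']
    -- If `m - 1` is occupied, then `m` is not, and `b` only moves `m - 1` to `m`: the circle stands
    -- still while time advances.
    by_cases hl : m - 1 ∈ V
    · have hmV : m ∉ V := fun h => hnot ⟨hl, h⟩
      have ho : occ V (m - 1) = 1 := by simp [occ, hl]
      rw [ho] at hG
      have hcirc : collapse m V' = collapse m V := by
        ext x
        rw [hC', hC, hb, hb, hb, h1]
        clear * - hm hl hmV
        grind
      rw [hcirc]
      exact hG.mono (by omega)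
    · have ho : occ V (m - 1) = 0 := by simp [occ, hl]
      rw [ho] at hG
      refine hG.push hm hlt (T' := collapse m V') fun x => ?_
      rw [hC', hC, hC, hb, hb, hb, h1]
      clear * - hm hl
      grind

theorem run_nil_ne {Q σ : Type} (A : PFA Q σ) [Nontrivial Q] : ¬ A.IsSyncWord [] := by
  rintro ⟨s, hs⟩
  obtain ⟨q, hq⟩ := exists_ne s
  exact hq (by simpa [run] using hs q)

/-- The first letter must be `b`, and it leaves exactly `m - 1` empty. The count starts there, since
the full set violates the invariant; this first letter supplies the `+ 1`. -/
theorem le_length_cerny_one {m : ℕ} (hm : 7 ≤ m) {w : List Letter}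
    (hw : (cerny (m + 1) 1).IsSyncWord w) : m ^ 2 + 1 ≤ w.length := by
  have : Nontrivial (Fin (m + 1)) := Fin.nontrivial_iff_two_le.2 (by omega)
  cases w with
  | nil => exact absurd hw (run_nil_ne _)
  | cons x w =>
    obtain ⟨s, hs⟩ := hw
    cases x with
    | a =>
      have := hs ⟨m - 1, by omega⟩
      rw [run, cerny_step_a_none (by simp only; omega) (by simp only; omega)] at this
      cases this
    | b =>
      have h0 : m ^ 2 ≤ 0 + w.length := by
        refine le_length_of_invariant (cerny (m + 1) 1)
          (fun S t => CircleInvariant m (positions S) t) (m ^ 2)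
          (fun S t x S' hI hf hb => hI.image (by omega) ⟨hf, hb⟩) ?_ w
          (univ.erase ⟨m - 1, by omega⟩) 0 s ?_ ?_ ?_
        · rintro q t ⟨-, hG⟩
          rw [positions_singleton, collapse, image_singleton] at hG
          have h1 := GapBound.singleton (by omega) hG
          have h2 := le_gapWeight_one hm
          have h3 : occ {q.val} (m - 1) ≤ min q.val (m - 1) := by
            unfold occ
            split_ifs with h
            · rw [mem_singleton] at h
              omega
            · exact Nat.zero_le _
          omega
        · have hpos : ∀ x, x ∈ positions (univ.erase (⟨m - 1, by omega⟩ : Fin (m + 1))) ↔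
              x < m + 1 ∧ x ≠ m - 1 := fun x => by simp [mem_positions]
          refine ⟨fun h => ((hpos _).1 h.1).2 rfl, ?_⟩
          have := gapBound_range m 1 (by omega)
          refine GapBound.mono (t := m - 1 + 1 * m) ?_ (by omega)
          convert this using 1
          ext x
          rw [mem_collapse (fun x hx => ((hpos x).1 hx).1), hpos, hpos, hpos, mem_range]
          omega
        · exact ⟨⟨0, by omega⟩, by simp; omega⟩
        · intro q hq
          have hq : q.val ≠ m - 1 := fun h => (mem_erase.1 hq).1 (Fin.ext h)
          by_cases hqm : q.val = m
          · have := hs ⟨m - 1, by omega⟩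
            rw [run, cerny_step_b_mid (by simp only; omega) (by simp only; omega),
              Option.bind_some] at this
            convert this using 2
            exact Fin.ext (by rw [hqm]; change m = m - 1 + 1; omega)
          · have := hs q
            rwa [run, cerny_step_b_lt (by omega)] at this
      rw [List.length_cons]
      omega

end PFA

namespace PFA

/-! ### Search for short synchronizing words of `C_n^1` on bit masks -/

/-- The image of a set of states of `C_n^1`, given as a bit mask, under a letter, if defined. -/
def maskStep (n s : ℕ) : Letter → ℕ
  | Letter.a => (2 * s) % 2 ^ n + s / 2 ^ (n - 1)
  | Letter.b => s % 2 ^ (n - 2) ||| s / 2 ^ (n - 1) |||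
      (if s.testBit (n - 2) then 2 ^ (n - 1) else 0)

/-- The bit masks reachable from `s` by one letter. -/
def maskSucc (n s : ℕ) : List ℕ :=
  if s.testBit (n - 2) then [maskStep n s Letter.b]
  else [maskStep n s Letter.a, maskStep n s Letter.b]

/-- No word of length less than `k` synchronizes one of the sets in `L`. -/
def noSyncBelow (n : ℕ) : ℕ → List ℕ → Bool
  | 0, _ => true
  | k + 1, L => L.all (fun s => s &&& (s - 1) != 0) && noSyncBelow n k (L.flatMap (maskSucc n)).dedup

/-- The bit mask `s` describes the set `S`. -/
def IsMask {n : ℕ} (s : ℕ) (S : Finset (Fin n)) : Prop :=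
  s < 2 ^ n ∧ ∀ x < n, s.testBit x = true ↔ x ∈ positions S

/-- `maskStep` is the action of `C_n^1`, and only powers of two describe singletons. -/
def MaskStepCorrect (n : ℕ) : Prop :=
  (∀ s < 2 ^ n, maskStep n s Letter.a < 2 ^ n ∧
    ∀ x < n, (maskStep n s Letter.a).testBit x = true ∨ s.testBit (n - 2) = true ↔
      (0 < x ∧ x + 1 < n ∧ s.testBit (x - 1) = true) ∨ (x = 0 ∧ s.testBit (n - 1) = true) ∨
        s.testBit (n - 2) = true) ∧
  (∀ s < 2 ^ n, maskStep n s Letter.b < 2 ^ n ∧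
    ∀ x < n, (maskStep n s Letter.b).testBit x = true ↔
      (x + 1 + 1 < n ∧ s.testBit x = true) ∨
        (n ≤ x + 1 ∧ x < n ∧ 0 < x ∧ s.testBit (x - 1) = true) ∨
        (x = 0 ∧ s.testBit (n - 1) = true)) ∧
  ∀ i < n, ∀ s < 2 ^ n, (∀ x < n, s.testBit x = true ↔ x = i) → s &&& (s - 1) = 0

set_option synthInstance.maxSize 1024 in
instance (n : ℕ) : Decidable (MaskStepCorrect n) := by
  unfold MaskStepCorrect
  infer_instance

theorem IsMask.image {n s : ℕ} {x : Letter} {S S' : Finset (Fin n)} (hn : 2 ≤ n)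
    (hc : MaskStepCorrect n) (hs : IsMask s S) (h : IsImage (cerny n 1) x S S') :
    IsMask (maskStep n s x) S' ∧ maskStep n s x ∈ maskSucc n s := by
  obtain ⟨hlt, hs⟩ := hs
  cases x with
  | a =>
    have h1 : s.testBit (n - 2) = false := by
      rw [← Bool.not_eq_true, hs _ (by omega)]
      exact h.not_mem_positions_a _ (by omega) (by omega)
    have ha := hc.1 s hlt
    -- The extra disjunct in `MaskStepCorrect` makes its clause vacuous where `a` is undefined; here
    -- it drops out.
    simp only [h1, Bool.false_eq_true, or_false] at ha
    refine ⟨⟨ha.1, fun x hx => ?_⟩, by simp [maskSucc, h1]⟩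
    rw [ha.2 x hx, h.mem_positions_a, hs (x - 1) (by omega), hs (n - 1) (by omega)]
  | b =>
    have hb := hc.2.1 s hlt
    refine ⟨⟨hb.1, fun x hx => ?_⟩, by unfold maskSucc; split_ifs <;> simp⟩
    rw [hb.2 x hx, h.mem_positions_b, hs x hx, hs (x - 1) (by omega), hs (n - 1) (by omega)]

/-- Breadth-first search as an invariant: the mask of the set reached at time `t` lies in a layer
from which no singleton occurs within the next `k - t` layers, that layer included. -/
theorem le_length_of_noSyncBelow {n : ℕ} (hn : 2 ≤ n) (hc : MaskStepCorrect n) {k : ℕ}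
    (hk : noSyncBelow n k [2 ^ n - 1] = true) {w : List Letter}
    (hw : (cerny n 1).IsSyncWord w) : k ≤ w.length := by
  obtain ⟨s, hs⟩ := hw
  have := le_length_of_invariant (cerny n 1)
    (fun S t => ∃ L, noSyncBelow n (k - t) L = true ∧ ∃ s ∈ L, IsMask s S) k ?_ ?_ w univ 0 s ?_
    ⟨s, mem_univ s⟩ fun q _ => hs q
  · omega
  · rintro S t x S' ⟨L, hL, s, hs, hS⟩ hf hb
    have him := hS.image hn hc ⟨hf, hb⟩
    refine ⟨(L.flatMap (maskSucc n)).dedup, ?_, _,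
      List.mem_dedup.2 (List.mem_flatMap.2 ⟨s, hs, him.2⟩), him.1⟩
    rcases Nat.eq_zero_or_pos (k - t) with h0 | h0
    · rw [show k - (t + 1) = 0 by omega]
      rfl
    · rw [show k - t = k - (t + 1) + 1 by omega, noSyncBelow, Bool.and_eq_true] at hL
      exact hL.2
  · rintro q t ⟨L, hL, s, hs, hS⟩
    by_contra! hlt
    rw [show k - t = k - (t + 1) + 1 by omega, noSyncBelow, Bool.and_eq_true,
      List.all_eq_true] at hL
    have h1 := hL.1 s hs
    rw [hc.2.2 q q.2 s hS.1 fun x hx => by rw [hS.2 x hx, positions_singleton, mem_singleton]] at h1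
    exact absurd h1 (by decide)
  · refine ⟨_, hk, _, List.mem_singleton_self _, ?_, fun x hx => ?_⟩
    · have := Nat.two_pow_pos n
      omega
    · simp [mem_positions, Nat.testBit_two_pow_sub_one, hx]

theorem lt_length_cerny_one {n : ℕ} (hn : 6 ≤ n) {w : List Letter}
    (hw : (cerny n 1).IsSyncWord w) : (n - 1) ^ 2 < w.length := by
  obtain rfl | rfl | ⟨m, hm, rfl⟩ : n = 6 ∨ n = 7 ∨ ∃ m, 7 ≤ m ∧ n = m + 1 := by
    rcases Nat.lt_or_ge n 8 with h | h
    · omega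
    · exact Or.inr (Or.inr ⟨n - 1, by omega, by omega⟩)
  -- The values are `26 = 5 ^ 2 + 1` and `37 = 6 ^ 2 + 1`.
  · exact le_length_of_noSyncBelow (k := 26) (by norm_num) (by decide +kernel) (by decide +kernel) hw
  · exact le_length_of_noSyncBelow (k := 37) (by norm_num) (by decide +kernel) (by decide +kernel) hw
  · exact le_length_cerny_one hm hw

/-! ### Synchronizing words -/

section SyncWord

variable {Q σ : Type} (A : PFA Q σ) (e : ℕ → Q) (K : ℕ) (r : List σ) (b : σ)

/-- `j` repetitions of the word `u`. -/
def wordPow {σ : Type} (u : List σ) (j : ℕ) : List σ := (List.replicate j u).flatten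

theorem wordPow_add (u : List σ) (i j : ℕ) : wordPow u (i + j) = wordPow u i ++ wordPow u j := by
  rw [wordPow, List.replicate_add, List.flatten_append]; rfl

theorem wordPow_succ (u : List σ) (j : ℕ) : wordPow u (j + 1) = u ++ wordPow u j := by
  simp [wordPow, List.replicate_succ]

variable {A e K r b}

theorem run_wordPow_rotate (hr : ∀ x < K, A.run (e x) r = some (e (x + 1))) (j x : ℕ)
    (h : x + j ≤ K) : A.run (e x) (wordPow r j) = some (e (x + j)) := by
  induction j generalizing x with
  | zero => rfl
  | succ j ih =>
    rw [wordPow_succ, run_append, hr x (by omega), Option.bind_some, ih _ (by omega)]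
    congr 2
    omega

/-- The circle has `K + 1` states, so `r^K` rotates one step backwards; `b` then returns `0`, which
went to `K`, to `0`. Truncated subtraction covers both cases. -/
theorem run_round (hr : ∀ x < K, A.run (e x) r = some (e (x + 1)))
    (hrK : A.run (e K) r = some (e 0)) (hb : ∀ x < K, A.run (e x) [b] = some (e x))
    (hbK : A.run (e K) [b] = some (e 0)) (x : ℕ) (hx : x ≤ K) :
    A.run (e x) (wordPow r K ++ [b]) = some (e (x - 1)) := by
  rw [run_append]
  rcases Nat.eq_zero_or_pos x with rfl | h0
  · rw [run_wordPow_rotate hr K 0 (by omega), Option.bind_some, zero_add, hbK]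
  · have hK : wordPow r K = wordPow r (K - x) ++ (wordPow r 1 ++ wordPow r (x - 1)) := by
      rw [← wordPow_add, ← wordPow_add]
      congr 1
      omega
    rw [hK, run_append,
      run_wordPow_rotate hr (K - x) x (by omega), Option.bind_some, Nat.add_sub_cancel' hx, run_append]
    have h1 : wordPow r 1 = r := by simp [wordPow]
    rw [h1, hrK, Option.bind_some, run_wordPow_rotate hr (x - 1) 0 (by omega), Option.bind_some,
      zero_add, hb _ (by omega)]

theorem run_wordPow_shrink {u : List σ} (hu : ∀ x ≤ K, A.run (e x) u = some (e (x - 1))) (j x : ℕ)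
    (hx : x ≤ K) : A.run (e x) (wordPow u j) = some (e (x - j)) := by
  induction j generalizing x with
  | zero => rfl
  | succ j ih =>
    rw [wordPow_succ, run_append, hu x hx, Option.bind_some, ih _ (by omega)]
    congr 2
    omega

/-- A Cerny word synchronizes if `r` rotates a circle of states `e 0, …, e K`, and `b` maps all
states to it, moving only `e K` among those on the circle. -/
theorem isSyncWord_rounds (hr : ∀ x < K, A.run (e x) r = some (e (x + 1)))
    (hrK : A.run (e K) r = some (e 0)) (hb : ∀ x < K, A.run (e x) [b] = some (e x))
    (hbK : A.run (e K) [b] = some (e 0)) (j : ℕ) (hj : j ≤ K)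
    (hstart : ∀ q, ∃ x ≤ j, A.run q [b] = some (e x)) :
    A.IsSyncWord ([b] ++ wordPow (wordPow r K ++ [b]) j) := by
  refine ⟨e 0, fun q => ?_⟩
  obtain ⟨x, hx, hq⟩ := hstart q
  rw [run_append, hq, Option.bind_some,
    run_wordPow_shrink (run_round hr hrK hb hbK) j x (by omega)]
  congr 2
  omega

end SyncWord

theorem run_singleton {Q σ : Type} (A : PFA Q σ) (q : Q) (x : σ) : A.run q [x] = A.step q x := by
  simp [run]

theorem exists_isSyncWord_cerny_zero {n : ℕ} (hn : 2 ≤ n) :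
    ∃ w, (cerny n 0).IsSyncWord w ∧ w.length = (n - 1) ^ 2 := by
  let e : ℕ → Fin n := fun x => ⟨min x (n - 1), by omega⟩
  have he : ∀ x (h : x < n), e x = ⟨x, h⟩ := fun x h => Fin.ext (min_eq_left (by omega))
  -- After the initial `b` the last state is empty, so `n - 2` rounds suffice; the length is `1 + (n
  -- - 2) * n = (n - 1) ^ 2`.
  refine ⟨_, isSyncWord_rounds (e := e) (K := n - 1) (r := [Letter.a]) (b := Letter.b)
    (fun x hx => ?_) ?_ (fun x hx => ?_) ?_ (n - 2) (by omega) (fun q => ?_), ?_⟩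
  · rw [run_singleton, he x (by omega), he (x + 1) (by omega),
      cerny_step_a_lt (by simp only; omega)]
  · rw [run_singleton, he (n - 1) (by omega), he 0 (by omega),
      cerny_step_a_last (by simp only; omega)]
  · rw [run_singleton, he x (by omega), cerny_step_b_lt (by simp only; omega)]
  · rw [run_singleton, he (n - 1) (by omega), he 0 (by omega),
      cerny_step_b_last (by simp only; omega)]
  · rw [run_singleton]
    by_cases h : q.val + 1 = n
    · exact ⟨0, Nat.zero_le _, by rw [cerny_step_b_last h, he 0 (by omega)]⟩
    · exact ⟨q, by omega, by rw [cerny_step_b_lt (by omega), he q q.2]⟩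
  · obtain ⟨k, rfl⟩ : ∃ k, n = k + 2 := ⟨n - 2, by omega⟩
    simp [wordPow]
    ring

/-- The circle omits state `m - 1`: the word `ab` rotates `0, …, m - 2, m`, its `b` carrying a token
on from `m - 1` to `m`. -/
theorem isSynchronizing_cerny_one {m : ℕ} (hm : 2 ≤ m) : (cerny (m + 1) 1).IsSynchronizing := by
  let e : ℕ → Fin (m + 1) := fun x => ⟨if x < m - 1 then x else m, by split_ifs <;> omega⟩
  have he : ∀ x (h : x < m + 1), x < m - 1 → e x = ⟨x, h⟩ := fun x h hx => Fin.ext (if_pos hx)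
  have he' : e (m - 1) = ⟨m, by omega⟩ := Fin.ext (if_neg (lt_irrefl _))
  refine ⟨_, isSyncWord_rounds (e := e) (K := m - 1)
    (r := [Letter.a, Letter.b]) (b := Letter.b) (fun x hx => ?_) ?_ (fun x hx => ?_) ?_ (m - 1)
    le_rfl (fun q => ?_)⟩
  · rw [he x (by omega) hx, run, cerny_step_a_lt (by simp only; omega), Option.bind_some,
      run_singleton]
    by_cases h : x + 1 < m - 1
    · rw [cerny_step_b_lt (by simp only; omega), he (x + 1) (by omega) h]
    · have hx' : e (x + 1) = ⟨m, by omega⟩ := Fin.ext (if_neg h)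
      rw [cerny_step_b_mid (by simp only; omega) (by simp only; omega), hx']
      congr 2
      simp only
      omega
  · rw [he', run, cerny_step_a_last rfl, Option.bind_some, run_singleton,
      cerny_step_b_lt (by simp only; omega), he 0 (by omega) (by omega)]
  · rw [he x (by omega) hx, run_singleton, cerny_step_b_lt (by simp only; omega)]
  · rw [he', run_singleton, cerny_step_b_last rfl, he 0 (by omega) (by omega)]
  · rw [run_singleton]
    rcases lt_trichotomy q.val (m - 1) with h | h | h
    · exact ⟨q, by omega, by rw [cerny_step_b_lt (by omega), he q q.2 h]⟩
    · refine ⟨m - 1, le_rfl, ?_⟩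
      rw [cerny_step_b_mid (by omega) (by omega), he']
      congr 2
      omega
    · refine ⟨0, Nat.zero_le _, ?_⟩
      rw [cerny_step_b_last (by omega), he 0 (by omega) (by omega)]

/-- The two letters, as a finite type. -/
def letterEquiv : Bool ≃ Letter where
  toFun x := if x then Letter.a else Letter.b
  invFun
    | Letter.a => true
    | Letter.b => false
  left_inv x := by cases x <;> rfl
  right_inv x := by cases x <;> rfl

instance : Fintype Letter := Fintype.ofEquiv Bool letterEquiv

theorem cerny_zero_isDFA (n : ℕ) : (cerny n 0).IsDFA := by
  intro q x
  have hq := q.2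
  by_cases h : q.val + 0 + 1 < n <;> cases x
  · rw [cerny_step_a_lt h]; simp
  · rw [cerny_step_b_lt h]; simp
  · rw [cerny_step_a_last (by omega)]; simp
  · rw [cerny_step_b_last (by omega)]; simp

end PFA

/-! ### Comparison of the maximal thresholds -/

theorem mainTheorem7 (n : ℕ) (hn : 6 ≤ n) :
    -- both automata have synchronizing words, and their reset thresholds compare as claimed
    ((PFA.cerny n 0).IsSynchronizing ∧ (PFA.cerny n 1).IsSynchronizing ∧
      (PFA.cerny n 0).resetThreshold = (n - 1) ^ 2 ∧
      (PFA.cerny n 1).resetThreshold > (PFA.cerny n 0).resetThreshold) ∧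
    -- `p(n, 2)` is a maximum and exceeds the Cerny bound
    (IsGreatest (PFA.thresholdsPFA n 2) (PFA.maxThresholdPFA n 2) ∧
      PFA.maxThresholdPFA n 2 > (n - 1) ^ 2) ∧
    -- `d(n)` is a maximum, and `p(n, 2)` exceeds it if the Cerny conjecture holds
    (IsGreatest (PFA.thresholdsDFA n) (PFA.maxThresholdDFA n) ∧
      (PFA.CernyConjecture → PFA.maxThresholdPFA n 2 > PFA.maxThresholdDFA n)) := by
  obtain ⟨w, hw, hlen⟩ := PFA.exists_isSyncWord_cerny_zero (n := n) (by omega)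
  have hs0 : (PFA.cerny n 0).IsSynchronizing := ⟨w, hw⟩
  have hs1 : (PFA.cerny n 1).IsSynchronizing := by
    obtain ⟨m, rfl⟩ : ∃ m, n = m + 1 := ⟨n - 1, by omega⟩
    exact PFA.isSynchronizing_cerny_one (by omega)
  have hr0 : (PFA.cerny n 0).resetThreshold = (n - 1) ^ 2 := by
    refine le_antisymm (hlen ▸ PFA.resetThreshold_le _ hw) ?_
    obtain ⟨v, hv, hvl⟩ := PFA.exists_isSyncWord_length _ hs0
    exact hvl ▸ PFA.le_length_cerny_zero (by omega) hv
  have hr1 : (n - 1) ^ 2 < (PFA.cerny n 1).resetThreshold := by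
    obtain ⟨v, hv, hvl⟩ := PFA.exists_isSyncWord_length _ hs1
    exact hvl ▸ PFA.lt_length_cerny_one hn hv
  have hmem1 : (PFA.cerny n 1).resetThreshold ∈ PFA.thresholdsPFA n 2 :=
    ⟨Fin n, PFA.Letter, inferInstance, inferInstance, PFA.cerny n 1, Fintype.card_fin n,
      (Fintype.card_congr PFA.letterEquiv).symm.trans Fintype.card_bool, hs1, rfl⟩
  have hmem0 : (PFA.cerny n 0).resetThreshold ∈ PFA.thresholdsDFA n :=
    ⟨Fin n, PFA.Letter, inferInstance, inferInstance, PFA.cerny n 0, Fintype.card_fin n,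
      PFA.cerny_zero_isDFA n, hs0, rfl⟩
  have hbddP := PFA.bddAbove_thresholdsPFA n 2
  have hbddD := PFA.bddAbove_thresholdsDFA n
  have hp : (n - 1) ^ 2 < PFA.maxThresholdPFA n 2 := hr1.trans_le (le_csSup hbddP hmem1)
  have hd : PFA.maxThresholdDFA n ∈ PFA.thresholdsDFA n := Nat.sSup_mem ⟨_, hmem0⟩ hbddD
  refine ⟨⟨hs0, hs1, hr0, hr0 ▸ hr1⟩, ⟨⟨Nat.sSup_mem ⟨_, hmem1⟩ hbddP, fun r hr =>
    le_csSup hbddP hr⟩, hp⟩, ⟨hd, fun r hr => le_csSup hbddD hr⟩, fun hC => ?_⟩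
  refine lt_of_le_of_lt ?_ hp
  obtain ⟨Q, σ, _, _, A, hcard, hA, hsync, hr⟩ := hd
  obtain ⟨v, hv, hvl⟩ := hC Q σ A hA hsync
  rw [← hr, ← hcard]
  exact (A.resetThreshold_le hv).trans hvl
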